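/- Let $E$ be a Euclidean space with inner product $\langle\cdot,\cdot\rangle$, let $Y\subset E$ be nonempty, convex and compact, let $\|\cdot\|$ be a norm on $E$ with conjugate norm $\|\xi\|_*=\max_{\|x\|\le1}\langle\xi,x\rangle$, and let $\omega:Y\to\mathbb R$ be continuous and convex, with a selection $\omega'(y)\in\partial\omega(y)$ that is continuous on $Y^o=\{y\in Y:\partial\omega(y)\ne\emptyset\}$ and satisfies $\langle\omega'(y)-\omega'(z),y-z\rangle\ge\|y-z\|^2$ for $y,z\in Y^o$. Put $\Omega=\sqrt{2[\max_Y\omega-\min_Y\omega]}$ and $y_\omega=\operatorname{argmin}_Y\omega$. Let $g:Y\to E$ be a vector field with $\|g(y)\|_*\le L[g]<\infty$ for all $y\in Y$. For $y\in Y$ put $h_y(z)=\langle g(y),y-z\rangle$; for search points $y_1,\dots,y_t$ let $\mathcal F_t$ be the set of the convex combinations $\sum_{\tau\le t}\lambda_\tau h_{y_\tau}$, each given by its weights $\lambda_\tau\ge0$, $\sum_\tau\lambda_\tau=1$. The Non-Euclidean Restricted Memory Level method with memory $m\ge1$, level parameter $\gamma\in(0,1)$, phase parameter $\theta\in(0,1)$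 and target $\varepsilon>0$ works as follows. Initialization (step 1): $y_1=y_\omega$, compute $g(y_1)$ and $f_1=\max_Yh_{y_1}$. If $f_1=0$, terminate with output $h_{y_1}$; otherwise begin phase 1. Beginning of phase $s$, with $t$ search points built so far and with $f_s>0$: put $\ell_s=\gamma f_s$, choose any $m$ functions in $\mathcal F_t$, forming the memory $h_1,\dots,h_m$, such that the closure of $\{y\in Y:h_j(y)>\ell_s,\ 1\le j\le m\}$ is nonempty, and let $u=y_\omega$ be the current search point. A step of phase $s$, with $t$ search points built so far, memory $h_1,\dots,h_m$ and current search point $u$: put $y_{t+1}=u$, compute $g(u)$, put $h_{m+1}=h_u$, and solve $\mathrm{Opt}=\max_{y\in Y}\min_{1\le j\le m+1}h_j(y)$, getting weights $\lambda_j\ge0$, $\sum_j\lambda_j=1$, such that $h=\sum_j\lambda_jh_j$ satisfies $\max_Yh=\mathrm{Opt}$. (A) If $\mathrm{Opt}\le\varepsilon$, terminate with output $h\in\mathcal F_{t+1}$. (B) Otherwise, if $\mathrm{Opt}<\ell_s+\theta(f_s-\ell_s)$, begin phase $s+1$ with $f_{s+1}=\mathrm{Opt}$. (C) Otherwise let $u^+$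 be the minimizer of $\omega$ over $\{y\in Y:h_j(y)\ge\ell_s,\ 1\le j\le m+1\}$, with Lagrange multipliers $\mu_j\ge0$ such that $\mu_j[h_j(u^+)-\ell_s]=0$ for all $j$ and $\langle\omega'(u^+)-\sum_j\mu_j\nabla h_j,\,y-u^+\rangle\ge0$ for all $y\in Y$. If $\mu=\sum_j\mu_j>0$, the new memory consists of $\mu^{-1}\sum_j\mu_jh_j$ and of any $m-1$ of the functions $h_1,\dots,h_{m+1}$; if $\mu=0$, it consists of any $m$ of them. Go on with phase $s$, with the search point $u^+$. Claim. For every $\varepsilon>0$ and whatever choices are made, every step of the method can be carried out, and the method terminates after finitely many steps $t$, with an execution protocol $\{y_\tau,g(y_\tau)\}_{\tau=1}^t$, $y_\tau\in Y$, and an accuracy certificate $\lambda_1,\dots,\lambda_t\ge0$, $\sum_\tau\lambda_\tau=1$ (the weights of the output function), of resolution $$\max_{y\in Y}\sum_{\tau=1}^t\lambda_\tau\langle g(y_\tau),y_\tau-y\rangle\le\varepsilon .$$ Counting the initialization as a step, so that the number of steps $t$ is the number of evaluations of $g$, if $\varepsilon\le\Omega L[g]$ then $$t\le C(\gamma,\theta)\,\frac{\Omega^2L^2[g]}{\varepsilon^2},\qquad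 C(\gamma,\theta)=\frac{1+\gamma^2}{\gamma^2\bigl[1-(\gamma+(1-\gamma)\theta)^2\bigr]},$$ and if $\varepsilon>\Omega L[g]$ then $t\le2$. -/

import Mathlib

namespace NERML

noncomputable section

/-- The norm conjugate to `nrm` with respect to the inner product:
`‖ξ‖_* = sup {⟪ξ, x⟫ : ‖x‖ ≤ 1}`. -/
def dualNorm {E : Type*} [NormedAddCommGroup E] [InnerProductSpace ℝ E]
    (nrm : Seminorm ℝ E) (ξ : E) : ℝ :=
  sSup {r : ℝ | ∃ x : E, nrm x ≤ 1 ∧ r = inner ℝ ξ x}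

/-- The subdifferential at `y` of a function given on `Y`. -/
def subdiff {E : Type*} [NormedAddCommGroup E] [InnerProductSpace ℝ E]
    (Y : Set E) (ω : E → ℝ) (y : E) : Set E :=
  {p : E | ∀ z ∈ Y, ω y + inner ℝ p (z - y) ≤ ω z}

/-- `Y^o`, the set of the points of `Y` at which the subdifferential is nonempty. -/
def subdiffDomain {E : Type*} [NormedAddCommGroup E] [InnerProductSpace ℝ E]
    (Y : Set E) (ω : E → ℝ) : Set E :=
  {y : E | y ∈ Y ∧ (subdiff Y ω y).Nonempty}

/-- A convex compact nonempty set `Y` in a Euclidean space with a proximal setup: a norm `nrm`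
(in general not the Euclidean one) and a distance-generating function `ω` on `Y`, with a continuous
selection `ω'` of its subdifferentials; only the values of `ω` on `Y` and of `ω'` on `Y^o`
matter. -/
structure ProximalSetup (E : Type*) [NormedAddCommGroup E] [InnerProductSpace ℝ E] where
  Y : Set E
  nonempty_Y : Y.Nonempty
  convex_Y : Convex ℝ Y
  isCompact_Y : IsCompact Y
  nrm : Seminorm ℝ E
  nrm_definite : ∀ x : E, nrm x = 0 → x = 0
  ω : E → ℝ
  continuousOn_ω : ContinuousOn ω Y
  convexOn_ω : ConvexOn ℝ Y ω
  ω' : E → E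
  ω'_mem : ∀ y ∈ subdiffDomain Y ω, ω' y ∈ subdiff Y ω y
  continuousOn_ω' : ContinuousOn ω' (subdiffDomain Y ω)
  strongly_convex : ∀ y ∈ subdiffDomain Y ω, ∀ z ∈ subdiffDomain Y ω,
    nrm (y - z) ^ 2 ≤ inner ℝ (ω' y - ω' z) (y - z)

/-- The `ω`-diameter `Ω[Y, ω]`. -/
def ProximalSetup.diam {E : Type*} [NormedAddCommGroup E] [InnerProductSpace ℝ E]
    (S : ProximalSetup E) : ℝ :=
  Real.sqrt (2 * (sSup (S.ω '' S.Y) - sInf (S.ω '' S.Y)))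

/-- `y ∈ Argmin_U ω`. -/
def ProximalSetup.IsArgmin {E : Type*} [NormedAddCommGroup E] [InnerProductSpace ℝ E]
    (S : ProximalSetup E) (U : Set E) (y : E) : Prop :=
  y ∈ U ∧ ∀ z ∈ U, S.ω y ≤ S.ω z

/-- An execution protocol of length `t`: the pairs (search point, value of the vector field). -/
abbrev Protocol (E : Type*) (t : ℕ) := Fin t → E × E

/-- The affine function `z ↦ ∑ i, w i ⟪g i, y i - z⟫` with weights `w` over the protocol
`P i = (y i, g i)`. The family `F_S` is represented by the weights in the standard simplex. -/
def affVal {E : Type*} [NormedAddCommGroup E] [InnerProductSpace ℝ E] {t : ℕ}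
    (P : Protocol E t) (w : Fin t → ℝ) (z : E) : ℝ :=
  ∑ i, w i * inner ℝ (P i).2 ((P i).1 - z)

/-- The (constant) gradient of the affine function `affVal P w`. -/
def affGrad {E : Type*} [NormedAddCommGroup E] [InnerProductSpace ℝ E] {t : ℕ}
    (P : Protocol E t) (w : Fin t → ℝ) : E :=
  -∑ i, w i • (P i).2

/-- `max_{z ∈ Y} ∑ i, w i ⟪g i, y i - z⟫`: the resolution of the certificate `w` at the
protocol `P`. -/
def resolution {E : Type*} [NormedAddCommGroup E] [InnerProductSpace ℝ E] {t : ℕ}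
    (Y : Set E) (P : Protocol E t) (w : Fin t → ℝ) : ℝ :=
  sSup (affVal P w '' Y)

/-- `max_{z ∈ Y} min_j h_j(z)` for the affine functions `h_j = affVal P (H j)`. -/
def optVal {E : Type*} [NormedAddCommGroup E] [InnerProductSpace ℝ E] {t k : ℕ}
    (Y : Set E) (P : Protocol E t) (H : Fin k → Fin t → ℝ) : ℝ :=
  sSup ((fun z => ⨅ j, affVal P (H j) z) '' Y)

/-- `∑ j, c j h_j`, in terms of the weights of the `h_j`. -/
def comb {t k : ℕ} (c : Fin k → ℝ) (H : Fin k → Fin t → ℝ) : Fin t → ℝ :=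
  fun i => ∑ j, c j * H j i

/-- What the method stores at the beginning of a step of a phase, after `t` calls to the
oracle. -/
structure State (E : Type*) (m t : ℕ) where
  /-- all search points so far, with the values of the vector field -/
  P : Protocol E t
  /-- the number `f_s` of the current phase -/
  f : ℝ
  /-- the weights of the `m` affine functions kept in the memory -/
  mem : Fin m → Fin t → ℝ
  /-- the current search point, at which the oracle will be called -/
  u : E

/-- The protocol extended by the current search point. -/
def State.newP {E : Type*} {m t : ℕ} (σ : State E m t) (g : E → E) : Protocol E (t + 1) :=
  Fin.snoc (α := fun _ => E × E) σ.P (σ.u, g σ.u)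

/-- The `m + 1` functions of the step, as weights over the extended protocol: the `m` functions in
the memory, and last the function `z ↦ ⟪g u, u - z⟫`. -/
def State.bundle {E : Type*} {m t : ℕ} (σ : State E m t) : Fin (m + 1) → Fin (t + 1) → ℝ :=
  Fin.snoc (α := fun _ => Fin (t + 1) → ℝ)
    (fun j => Fin.snoc (α := fun _ => ℝ) (σ.mem j) 0) (Pi.single (Fin.last t) 1)

/-- The auxiliary problem `max_{z ∈ Y} min_{1 ≤ j ≤ m + 1} h_j(z)` of the step. -/
def State.opt {E : Type*} [NormedAddCommGroup E] [InnerProductSpace ℝ E] {m t : ℕ}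
    (S : ProximalSetup E) (g : E → E) (σ : State E m t) : ℝ :=
  optVal S.Y (σ.newP g) σ.bundle

/-- `σ` begins a phase with protocol `P` and `f_s = f`: its memory consists of any `m` elements of
`F_S` for which the closure of `{y ∈ Y : h_j(y) > γ f for all j}` is nonempty, and its search point
is the `ω`-center of `Y`. -/
def BeginsPhase {E : Type*} [NormedAddCommGroup E] [InnerProductSpace ℝ E] {m t : ℕ}
    (S : ProximalSetup E) (γ : ℝ) (P : Protocol E t) (f : ℝ) (σ : State E m t) : Prop :=
  σ.P = P ∧ σ.f = f ∧
  (∀ j, σ.mem j ∈ stdSimplex ℝ (Fin t)) ∧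
  (closure {y : E | y ∈ S.Y ∧ ∀ j, γ * f < affVal P (σ.mem j) y}).Nonempty ∧
  S.IsArgmin S.Y σ.u

/-- `lam` are the weights obtained with the auxiliary problem of the step: the convex combination
of the `m + 1` functions with the weights `lam` has the maximum `Opt` over `Y`. -/
def SolvesAux {E : Type*} [NormedAddCommGroup E] [InnerProductSpace ℝ E] {m t : ℕ}
    (S : ProximalSetup E) (g : E → E) (σ : State E m t) (lam : Fin (m + 1) → ℝ) : Prop :=
  lam ∈ stdSimplex ℝ (Fin (m + 1)) ∧
  resolution S.Y (σ.newP g) (comb lam σ.bundle) = σ.opt S g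

/-- `σ'` follows `σ` in the same phase: the new search point minimizes `ω` over
`{y ∈ Y : h_j(y) ≥ ℓ, 1 ≤ j ≤ m + 1}`, `ℓ = γ f_s`, and `μ` are Lagrange multipliers of this
problem. If `∑ μ_j > 0`, the new memory consists of the aggregate `(∑ μ_j)⁻¹ ∑ μ_j h_j` (first) and
of `m - 1` of the old functions, any two being discarded (`e 0` and the one outside the range of
`e`); if `∑ μ_j = 0`, of `m` of the old functions, any one being discarded. -/
def ContinuesPhase {E : Type*} [NormedAddCommGroup E] [InnerProductSpace ℝ E] {m t : ℕ}
    (S : ProximalSetup E) (g : E → E) (γ : ℝ) (σ : State E m t) (σ' : State E m (t + 1)) : Prop :=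
  σ'.P = σ.newP g ∧ σ'.f = σ.f ∧
  S.IsArgmin {y : E | y ∈ S.Y ∧ ∀ j, γ * σ.f ≤ affVal (σ.newP g) (σ.bundle j) y} σ'.u ∧
  ∃ (μ : Fin (m + 1) → ℝ) (e : Fin m ↪ Fin (m + 1)),
    (∀ j, 0 ≤ μ j) ∧
    (∀ j, μ j * (affVal (σ.newP g) (σ.bundle j) σ'.u - γ * σ.f) = 0) ∧
    (∀ y ∈ S.Y,
      0 ≤ inner ℝ (S.ω' σ'.u - ∑ j, μ j • affGrad (σ.newP g) (σ.bundle j)) (y - σ'.u)) ∧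
    (0 < ∑ j, μ j → ∀ j : Fin m,
      σ'.mem j = if j.val = 0 then comb (fun i => (∑ k, μ k)⁻¹ * μ i) σ.bundle
        else σ.bundle (e j)) ∧
    (∑ j, μ j = 0 → ∀ j : Fin m, σ'.mem j = σ.bundle (e j))

/-- The configurations of the method: before the start, in the course of the run, and after
termination, with the output (execution protocol and weights). -/
inductive Config (E : Type*) (m : ℕ) where
  | start : Config E m
  | running (t : ℕ) (σ : State E m t) : Config E m
  | done (t : ℕ) (P : Protocol E t) (lam : Fin t → ℝ) : Config E m

/-- One step of the method, with one call to the oracle `g`. All choices that the method leaves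
open are left open here. -/
inductive Step {E : Type*} [NormedAddCommGroup E] [InnerProductSpace ℝ E] {m : ℕ}
    (S : ProximalSetup E) (g : E → E) (γ θ ε : ℝ) : Config E m → Config E m → Prop
  /-- initialization, `f_1 = 0` -/
  | initStop (y : E) (hy : S.IsArgmin S.Y y)
      (hf : resolution S.Y (fun _ : Fin 1 => (y, g y)) (fun _ => 1) = 0) :
      Step S g γ θ ε Config.start (Config.done 1 (fun _ => (y, g y)) (fun _ => 1))
  /-- initialization, `f_1 > 0`: the first phase begins -/
  | initPhase (y : E) (hy : S.IsArgmin S.Y y)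
      (hf : 0 < resolution S.Y (fun _ : Fin 1 => (y, g y)) (fun _ => 1))
      (σ : State E m 1)
      (hσ : BeginsPhase S γ (fun _ => (y, g y))
        (resolution S.Y (fun _ : Fin 1 => (y, g y)) (fun _ => 1)) σ) :
      Step S g γ θ ε Config.start (Config.running 1 σ)
  /-- case A: termination -/
  | terminate (t : ℕ) (σ : State E m t) (hA : σ.opt S g ≤ ε)
      (lam : Fin (m + 1) → ℝ) (hlam : SolvesAux S g σ lam) :
      Step S g γ θ ε (Config.running t σ)
        (Config.done (t + 1) (σ.newP g) (comb lam σ.bundle))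
  /-- case B: the next phase begins, with `f_{s+1} = max_Y h^{s+1} = Opt`, where
  `h^{s+1} = ∑ j, lam j h_j` -/
  | newPhase (t : ℕ) (σ : State E m t) (hA : ε < σ.opt S g)
      (hB : σ.opt S g < γ * σ.f + θ * (σ.f - γ * σ.f))
      (lam : Fin (m + 1) → ℝ) (hlam : SolvesAux S g σ lam)
      (σ' : State E m (t + 1))
      (hσ' : BeginsPhase S γ (σ.newP g)
        (resolution S.Y (σ.newP g) (comb lam σ.bundle)) σ') :
      Step S g γ θ ε (Config.running t σ) (Config.running (t + 1) σ')
  /-- case C: the phase goes on -/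
  | samePhase (t : ℕ) (σ : State E m t) (hA : ε < σ.opt S g)
      (hC : γ * σ.f + θ * (σ.f - γ * σ.f) ≤ σ.opt S g)
      (σ' : State E m (t + 1)) (hσ' : ContinuesPhase S g γ σ σ') :
      Step S g γ θ ε (Config.running t σ) (Config.running (t + 1) σ')

/-- The configurations that the method can reach in exactly `T` steps. -/
inductive ReachedIn {E : Type*} [NormedAddCommGroup E] [InnerProductSpace ℝ E] {m : ℕ}
    (S : ProximalSetup E) (g : E → E) (γ θ ε : ℝ) : ℕ → Config E m → Prop
  | zero : ReachedIn S g γ θ ε 0 Config.start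
  | succ (T : ℕ) (c c' : Config E m) (hc : ReachedIn S g γ θ ε T c)
      (hstep : Step S g γ θ ε c c') : ReachedIn S g γ θ ε (T + 1) c'

/-- `C(γ, θ)`. -/
def complexityConst (γ θ : ℝ) : ℝ :=
  (1 + γ ^ 2) / (γ ^ 2 * (1 - (γ + (1 - γ) * θ) ^ 2))

end

end NERML

namespace NERML

open Filter Topology

/-! Write `D = Ω L` and `q = γ + (1 - γ) θ`. Within a phase, every search point `u` minimizes `ω`
over the part of `Y` where the memory functions are at least `ℓ = γ f`; the aggregate of the
constraints with their multipliers keeps this true whatever else is discarded. The next point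
satisfies `h_u(u⁺) ≥ ℓ`, so it is at distance at least `ℓ / L` from `u`, and the quadratic growth of
`ω` gives `ω(u⁺) - ω(u) ≥ γ² f² / (2 L²)`. As `ω` varies by at most `Ω² / 2` on `Y`, a phase makes
at most `D² / (γ² f²)` such moves and one last step; since `f ≤ D`, this is at most `(1 + γ²) D² /
(γ² f²)` steps. A new phase has `f_{s+1} < q f_s`, so the phase bounds sum like a geometric series,
which gives the factor `1 / (1 - q²)`. `RunInvariant.count` carries this sum as a potential
inequality.

The analytic difficulty is that `ω'` exists only on `Y^o`. `quadratic_growth` derives the growth of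
`ω` from the monotonicity of `ω'` there, and `inner_omega'_sub_nonneg` compares `ω'` with an
arbitrary subgradient. One theorem of the alternative yields both the Lagrange multipliers and the
minimax equality, hence the fact that every step can be made. -/

/-! ### A theorem of the alternative for finitely many convex functions -/

/-- The vectors lying strictly above some `(φ j y)_j` form an open convex set that misses the
origin. A separating functional has nonnegative coefficients because the set is closed under
increasing coordinates; normalizing them gives the weights. -/
theorem exists_mem_stdSimplex_sum_nonneg {E ι : Type*} [AddCommGroup E] [Module ℝ E] [Fintype ι]
    {Y : Set E} (hY : Y.Nonempty) {φ : ι → E → ℝ} (hφ : ∀ j, ConvexOn ℝ Y (φ j))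
    (h : ∀ y ∈ Y, ∃ j, 0 ≤ φ j y) :
    ∃ lam ∈ stdSimplex ℝ ι, ∀ y ∈ Y, 0 ≤ ∑ j, lam j * φ j y := by
  classical
  obtain ⟨y₀, hy₀⟩ := hY
  set A : Set (ι → ℝ) := {v | ∃ y ∈ Y, ∀ j, φ j y < v j} with hA
  have hAo : IsOpen A := by
    have : A = ⋃ y ∈ Y, ⋂ j, {v : ι → ℝ | φ j y < v j} := by
      ext v; simp [hA]
    rw [this]
    refine isOpen_biUnion fun y _ => isOpen_iInter_of_finite fun j => ?_
    exact isOpen_lt continuous_const (continuous_apply j)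
  have hAc : Convex ℝ A := by
    rintro v ⟨y, hy, hv⟩ w ⟨z, hz, hw⟩ a b ha hb hab
    obtain ⟨j₀, -⟩ := h y₀ hy₀
    refine ⟨a • y + b • z, (hφ j₀).1 hy hz ha hb hab, fun j => ?_⟩
    refine ((hφ j).2 hy hz ha hb hab).trans_lt ?_
    simp only [Pi.add_apply, Pi.smul_apply, smul_eq_mul]
    have h1 := hv j
    have h2 := hw j
    rcases ha.eq_or_lt with rfl | ha'
    · have : b = 1 := by linarith
      subst this; simpa using h2
    · nlinarith [mul_lt_mul_of_pos_left h1 ha', mul_le_mul_of_nonneg_left h2.le hb]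
  have h0 : (0 : ι → ℝ) ∉ A := by
    rintro ⟨y, hy, hv⟩
    obtain ⟨j, hj⟩ := h y hy
    exact absurd (hv j) (not_lt.2 hj)
  obtain ⟨f, hf⟩ := geometric_hahn_banach_open_point hAc hAo h0
  have hfs : ∀ v : ι → ℝ, f v = ∑ j, v j * f (Pi.single j 1) := by
    intro v
    conv_lhs => rw [pi_eq_sum_univ' v]
    simp only [map_sum, map_smul, smul_eq_mul]
  set c : ι → ℝ := fun j => -f (Pi.single j 1) with hcdef
  have hfc : ∀ v ∈ A, 0 < ∑ j, v j * c j := by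
    intro v hv
    have h1 := hf v hv
    rw [map_zero, hfs] at h1
    simp only [hcdef, mul_neg, Finset.sum_neg_distrib]
    linarith
  have hφc : ∀ y ∈ Y, 0 ≤ ∑ j, φ j y * c j := by
    intro y hy
    refine le_of_forall_pos_lt_add fun δ hδ => ?_
    set M := |∑ j, c j| + 1 with hM
    have hMp : 0 < M := by positivity
    have h1 := hfc (fun j => φ j y + δ / M) ⟨y, hy, fun j => by
      have : 0 < δ / M := by positivity
      linarith⟩
    simp only [add_mul, Finset.sum_add_distrib, ← Finset.mul_sum] at h1
    have h2 : δ / M * ∑ j, c j < δ := by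
      have h3 : ∑ j, c j < M := by rw [hM]; linarith [le_abs_self (∑ j, c j)]
      calc δ / M * ∑ j, c j < δ / M * M := mul_lt_mul_of_pos_left h3 (by positivity)
        _ = δ := by field_simp
    linarith
  have hc0 : ∀ j, 0 ≤ c j := by
    intro j
    by_contra! hneg
    set B := ∑ i, (φ i y₀ + 1) * c i with hB
    have hB0 : 0 < B := hfc (fun i => φ i y₀ + 1) ⟨y₀, hy₀, fun i => by simp⟩
    have hN : 0 < B / (-c j) := div_pos hB0 (by linarith)
    -- The shift of coordinate `j` is the one that brings the functional from `B` down to exactly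
    -- zero.
    have h1 := hfc (fun i => (φ i y₀ + 1) + if i = j then B / (-c j) else 0) ⟨y₀, hy₀, fun i => by
      dsimp only; split_ifs <;> linarith⟩
    simp only [add_mul _ (ite _ _ _), Finset.sum_add_distrib, ite_mul, zero_mul,
      Finset.sum_ite_eq', Finset.mem_univ, if_true] at h1
    have h2 : B / (-c j) * c j = -B := by
      have : c j ≠ 0 := hneg.ne
      field_simp
    rw [h2] at h1
    linarith
  have hsum : 0 < ∑ j, c j := by
    refine (Finset.sum_nonneg fun j _ => hc0 j).lt_of_ne fun h0 => ?_
    have hz := (Finset.sum_eq_zero_iff_of_nonneg fun j _ => hc0 j).1 h0.symm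
    have h1 := hfc (fun i => φ i y₀ + 1) ⟨y₀, hy₀, fun i => by simp⟩
    rw [Finset.sum_eq_zero fun j hj => by rw [hz j hj, mul_zero]] at h1
    exact lt_irrefl _ h1
  refine ⟨fun j => (∑ j, c j)⁻¹ * c j, ⟨fun j => ?_, ?_⟩, fun y hy => ?_⟩
  · exact mul_nonneg (inv_nonneg.2 hsum.le) (hc0 j)
  · rw [← Finset.mul_sum, inv_mul_cancel₀ hsum.ne']
  · have := mul_nonneg (inv_nonneg.2 hsum.le) (hφc y hy)
    rw [Finset.mul_sum] at this
    refine this.trans_eq (Finset.sum_congr rfl fun j _ => by ring)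

/-! ### The norm and its conjugate -/

theorem exists_norm_le_mul_seminorm {E : Type*} [NormedAddCommGroup E] [NormedSpace ℝ E]
    [FiniteDimensional ℝ E] (p : Seminorm ℝ E) (hp : ∀ x, p x = 0 → x = 0) :
    ∃ K : ℝ, 0 < K ∧ ∀ x, ‖x‖ ≤ K * p x := by
  have hcont : Continuous p := by
    have := p.convexOn.continuousOn_interior
    rwa [interior_univ, continuousOn_univ] at this
  rcases subsingleton_or_nontrivial E with hE | hE
  · exact ⟨1, one_pos, fun x => by simp [Subsingleton.elim x 0]⟩
  obtain ⟨x₀, hx₀, hmin⟩ := (isCompact_sphere (0 : E) 1).exists_isMinOn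
    (NormedSpace.sphere_nonempty.2 zero_le_one) hcont.continuousOn
  have hx₀' : 0 < p x₀ := by
    refine (apply_nonneg p x₀).lt_of_ne' fun h0 => ?_
    rw [hp x₀ h0] at hx₀
    simp at hx₀
  refine ⟨(p x₀)⁻¹, inv_pos.2 hx₀', fun x => ?_⟩
  rcases eq_or_ne x 0 with rfl | hx
  · simp
  have hx' : 0 < ‖x‖ := norm_pos_iff.2 hx
  have h1 : p x₀ ≤ p (‖x‖⁻¹ • x) := hmin (by simp [norm_smul, hx'.ne'])
  rw [map_smul_eq_mul, norm_inv, norm_norm, le_inv_mul_iff₀ hx'] at h1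
  rw [le_inv_mul_iff₀ hx₀']
  linarith

section
variable {E : Type*} [NormedAddCommGroup E] [InnerProductSpace ℝ E]

theorem bddAbove_dualNorm [FiniteDimensional ℝ E] {p : Seminorm ℝ E}
    (hp : ∀ x, p x = 0 → x = 0) (ξ : E) :
    BddAbove {r : ℝ | ∃ x : E, p x ≤ 1 ∧ r = inner ℝ ξ x} := by
  obtain ⟨K, hK, hle⟩ := exists_norm_le_mul_seminorm p hp
  refine ⟨‖ξ‖ * K, ?_⟩
  rintro r ⟨x, hx, rfl⟩
  refine (real_inner_le_norm ξ x).trans (mul_le_mul_of_nonneg_left ?_ (norm_nonneg _))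
  exact (hle x).trans (by nlinarith)

theorem dualNorm_nonneg [FiniteDimensional ℝ E] {p : Seminorm ℝ E}
    (hp : ∀ x, p x = 0 → x = 0) (ξ : E) : 0 ≤ dualNorm p ξ :=
  le_csSup (bddAbove_dualNorm hp ξ) ⟨0, by simp, by simp⟩

theorem inner_le_dualNorm_mul [FiniteDimensional ℝ E] {p : Seminorm ℝ E}
    (hp : ∀ x, p x = 0 → x = 0) (ξ x : E) : inner ℝ ξ x ≤ dualNorm p ξ * p x := by
  rcases eq_or_ne x 0 with rfl | hx
  · simp
  have hx' : 0 < p x := (apply_nonneg p x).lt_of_ne' fun h => hx (hp x h)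
  have h1 : inner ℝ ξ ((p x)⁻¹ • x) ≤ dualNorm p ξ :=
    le_csSup (bddAbove_dualNorm hp ξ) ⟨_, by rw [map_smul_eq_mul, norm_inv,
      Real.norm_of_nonneg hx'.le, inv_mul_cancel₀ hx'.ne'], rfl⟩
  rwa [inner_smul_right, inv_mul_le_iff₀ hx', mul_comm] at h1

end

/-! ### Subgradients and quadratic growth of the distance-generating function -/

theorem nonpos_of_forall_le_mul {a b : ℝ} (h : ∀ t : ℝ, 0 < t → t < 1 → a ≤ t * b) : a ≤ 0 := by
  have h1 : Tendsto (fun t : ℝ => t * b) (𝓝[>] 0) (𝓝 (0 * b)) :=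
    (tendsto_id.mono_left nhdsWithin_le_nhds).mul_const b
  rw [zero_mul] at h1
  refine ge_of_tendsto h1 ?_
  filter_upwards [Ioo_mem_nhdsGT (zero_lt_one' ℝ)] with t ht using h t ht.1 ht.2

section
variable {E : Type*} [NormedAddCommGroup E] [InnerProductSpace ℝ E]

/-- First-order optimality of a proximal point: compare `w` with `w + t (z - w)`, divide by `t` and
let `t` tend to zero. -/
theorem smul_sub_mem_subdiff {Y : Set E} (hY : Convex ℝ Y) {ω : E → ℝ} (hω : ConvexOn ℝ Y ω)
    {q w : E} {c : ℝ} (hw : w ∈ Y)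
    (hmin : ∀ z ∈ Y, ω w + c / 2 * ‖w - q‖ ^ 2 ≤ ω z + c / 2 * ‖z - q‖ ^ 2) :
    c • (q - w) ∈ subdiff Y ω w := by
  intro z hz
  suffices h : ω w + inner ℝ (c • (q - w)) (z - w) - ω z ≤ 0 by linarith
  refine nonpos_of_forall_le_mul (b := c / 2 * ‖z - w‖ ^ 2) fun t ht0 ht1 => ?_
  have h1 := hmin _ (hY.add_smul_sub_mem hw hz ⟨ht0.le, ht1.le⟩)
  have h2 : ω (w + t • (z - w)) ≤ (1 - t) * ω w + t * ω z := by
    have := hω.2 hw hz (sub_nonneg.2 ht1.le) ht0.le (by ring)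
    simp only [smul_eq_mul] at this
    rwa [show (1 - t) • w + t • z = w + t • (z - w) by module] at this
  have h3 : ‖w + t • (z - w) - q‖ ^ 2
      = ‖w - q‖ ^ 2 - 2 * t * inner ℝ (q - w) (z - w) + t ^ 2 * ‖z - w‖ ^ 2 := by
    have : w + t • (z - w) - q = t • (z - w) - (q - w) := by module
    rw [this, norm_sub_sq_real, norm_smul, inner_smul_left, real_inner_comm, norm_sub_rev w q,
      Real.norm_of_nonneg ht0.le]
    simp
    ring
  rw [h3] at h1
  rw [inner_smul_left]
  simp only [conj_trivial]
  have h4 : t * (ω w + c * inner ℝ (q - w) (z - w) - ω z) ≤ t * (t * (c / 2 * ‖z - w‖ ^ 2)) := by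
    nlinarith
  exact le_of_mul_le_mul_left h4 ht0

namespace ProximalSetup
variable (S : ProximalSetup E)

theorem exists_isArgmin {U : Set E} (hU : IsCompact U) (hne : U.Nonempty) (hUY : U ⊆ S.Y) :
    ∃ y, S.IsArgmin U y :=
  hU.exists_isMinOn hne (S.continuousOn_ω.mono hUY)

/-- The proximal point of `q` with a large penalty `c` has the subgradient `c (q - w)`. Subgradients
may blow up near a point outside `Y^o`, so the bound on the product `‖p‖ * ‖w - q‖` is what makes
later error terms vanish. -/
theorem exists_subdiff_near {q : E} (hq : q ∈ S.Y) {η : ℝ} (hη : 0 < η) :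
    ∃ w ∈ S.Y, ∃ p ∈ subdiff S.Y S.ω w, ‖w - q‖ < η ∧ ‖p‖ * ‖w - q‖ < η := by
  obtain ⟨y₀, hy₀, hmin₀⟩ := S.exists_isArgmin S.isCompact_Y S.nonempty_Y subset_rfl
  obtain ⟨δ, hδ, hcont⟩ := Metric.continuousOn_iff.1 S.continuousOn_ω q hq (η / 2) (by positivity)
  set r := min δ η with hr
  have hr0 : 0 < r := lt_min hδ hη
  -- With this penalty, leaving the ball of radius `r` costs more than `ω` can gain.
  set c := 2 * (S.ω q - S.ω y₀) / r ^ 2 + 1 with hc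
  have hM : 0 ≤ S.ω q - S.ω y₀ := sub_nonneg.2 (hmin₀ q hq)
  have hc0 : 0 < c := by positivity
  have hcr : 2 * (S.ω q - S.ω y₀) < c * r ^ 2 := by
    rw [hc, add_mul, div_mul_cancel₀ _ (by positivity)]
    nlinarith [pow_pos hr0 2]
  have hcontp : ContinuousOn (fun z => S.ω z + c / 2 * ‖z - q‖ ^ 2) S.Y :=
    S.continuousOn_ω.add (by fun_prop)
  obtain ⟨w, hw, hwmin⟩ := S.isCompact_Y.exists_isMinOn S.nonempty_Y hcontp
  have hwmin' : ∀ z ∈ S.Y, S.ω w + c / 2 * ‖w - q‖ ^ 2 ≤ S.ω z + c / 2 * ‖z - q‖ ^ 2 :=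
    fun z hz => hwmin hz
  have h1 := hwmin' q hq
  rw [sub_self, norm_zero] at h1
  have h2 : ‖w - q‖ < r := by
    have h3 := hmin₀ w hw
    have h4 : c * ‖w - q‖ ^ 2 < c * r ^ 2 := by linarith
    exact lt_of_pow_lt_pow_left₀ 2 hr0.le (lt_of_mul_lt_mul_left h4 hc0.le)
  refine ⟨w, hw, c • (q - w), smul_sub_mem_subdiff S.convex_Y S.convexOn_ω hw hwmin',
    h2.trans_le (min_le_right _ _), ?_⟩
  have h3 := hcont w hw (by rw [dist_eq_norm]; exact h2.trans_le (min_le_left _ _))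
  rw [Real.dist_eq, abs_lt] at h3
  rw [norm_smul, Real.norm_of_nonneg hc0.le, norm_sub_rev q w]
  nlinarith

/-- Approach `u` from the direction `y - u` through points `w` of `Y^o`: monotonicity gives `⟪ω' w -
G, w - u⟫ ≥ 0`, and the continuity of `ω'` on `Y^o` passes this to the limit after division by the
step length. -/
theorem inner_omega'_sub_nonneg {u G : E} (hu : u ∈ S.Y) (hG : G ∈ subdiff S.Y S.ω u) {y : E}
    (hy : y ∈ S.Y) : 0 ≤ inner ℝ (S.ω' u - G) (y - u) := by
  set t : ℕ → ℝ := fun n => 1 / ((n : ℝ) + 1) with ht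
  have ht0 : ∀ n, 0 < t n := fun n => by positivity
  have ht1 : ∀ n, t n ≤ 1 := fun n => by
    rw [ht, div_le_one (by positivity)]; linarith [n.cast_nonneg (α := ℝ)]
  have htlim : Tendsto t atTop (𝓝 0) := tendsto_one_div_add_atTop_nhds_zero_nat
  -- The accuracy `t²` is of smaller order than the step `t`, so that `(w - u) / t` still tends to
  -- `y - u`.
  choose w hwY p hp hw _ using fun n => S.exists_subdiff_near
    (S.convex_Y.add_smul_sub_mem hu hy ⟨(ht0 n).le, ht1 n⟩) (pow_pos (ht0 n) 2)
  have hwo : ∀ n, w n ∈ subdiffDomain S.Y S.ω := fun n => ⟨hwY n, p n, hp n⟩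
  have huo : u ∈ subdiffDomain S.Y S.ω := ⟨hu, G, hG⟩
  set v : ℕ → E := fun n => (t n)⁻¹ • (w n - u) with hv
  have hwv : ∀ n, w n = u + t n • v n := fun n => by
    rw [hv, smul_smul, mul_inv_cancel₀ (ht0 n).ne', one_smul]; abel
  have hvlim : Tendsto v atTop (𝓝 (y - u)) := by
    rw [tendsto_iff_norm_sub_tendsto_zero]
    refine squeeze_zero (fun n => norm_nonneg _) (fun n => ?_) htlim
    have h1 : w n - (u + t n • (y - u)) = t n • (v n - (y - u)) := by
      rw [hwv n]; module
    have h2 := hw n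
    rw [h1, norm_smul, Real.norm_of_nonneg (ht0 n).le, pow_two] at h2
    exact (lt_of_mul_lt_mul_left h2 (ht0 n).le).le
  have hwlim : Tendsto w atTop (𝓝 u) := by
    have := (htlim.smul hvlim).const_add u
    rw [zero_smul, add_zero] at this
    exact this.congr fun n => (hwv n).symm
  have hω' : Tendsto (fun n => S.ω' (w n)) atTop (𝓝 (S.ω' u)) :=
    (S.continuousOn_ω' u huo).tendsto.comp
      (tendsto_nhdsWithin_iff.2 ⟨hwlim, Eventually.of_forall hwo⟩)
  refine ge_of_tendsto' ((hω'.sub_const G).inner hvlim) fun n => ?_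
  have h1 := hG (w n) (hwY n)
  have h2 := S.ω'_mem _ (hwo n) u hu
  rw [← neg_sub (w n) u, inner_neg_right] at h2
  simp only [hv]
  rw [inner_smul_right, inner_sub_left]
  exact mul_nonneg (inv_nonneg.2 (ht0 n).le) (by linarith)

theorem sq_nrm_le_inner_sub {w z p q : E} (hw : w ∈ S.Y) (hp : p ∈ subdiff S.Y S.ω w)
    (hz : z ∈ S.Y) (hq : q ∈ subdiff S.Y S.ω z) :
    S.nrm (w - z) ^ 2 ≤ inner ℝ (p - q) (w - z) := by
  have h1 := S.inner_omega'_sub_nonneg hw hp hz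
  have h2 := S.inner_omega'_sub_nonneg hz hq hw
  have h3 := S.strongly_convex w ⟨hw, p, hp⟩ z ⟨hz, q, hq⟩
  rw [← neg_sub w z, inner_neg_right] at h1
  simp only [inner_sub_left] at *
  linarith

/-- Split the segment at `y = z + s (x - z)`: the known growth covers the piece from `z` to `y`, and
strong monotonicity covers the rest through a subgradient at `y`. As `y` may lie outside `Y^o`,
nearby points `w n` replace it. -/
theorem improve_quadratic_growth [FiniteDimensional ℝ E] {z q : E} (hz : z ∈ S.Y)
    (hq : q ∈ subdiff S.Y S.ω z) {c s : ℝ} (hs0 : 0 < s) (hs1 : s < 1)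
    (h : ∀ x ∈ S.Y, c * S.nrm (x - z) ^ 2 ≤ S.ω x - S.ω z - inner ℝ q (x - z)) :
    ∀ x ∈ S.Y, (s ^ 2 * c + s * (1 - s)) * S.nrm (x - z) ^ 2
      ≤ S.ω x - S.ω z - inner ℝ q (x - z) := by
  intro x hx
  have hnrm : Continuous S.nrm := by
    have := S.nrm.convexOn.continuousOn_interior
    rwa [interior_univ, continuousOn_univ] at this
  set t : ℕ → ℝ := fun n => 1 / ((n : ℝ) + 1) with ht
  have ht0 : ∀ n, 0 < t n := fun n => by positivity
  have htlim : Tendsto t atTop (𝓝 0) := tendsto_one_div_add_atTop_nhds_zero_nat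
  set y := z + s • (x - z) with hy
  have hyY : y ∈ S.Y := S.convex_Y.add_smul_sub_mem hz hx ⟨hs0.le, hs1.le⟩
  choose w hwY p hp hw hpw using fun n => S.exists_subdiff_near hyY (ht0 n)
  have hwlim : Tendsto w atTop (𝓝 y) := by
    rw [tendsto_iff_norm_sub_tendsto_zero]
    exact squeeze_zero (fun n => norm_nonneg _) (fun n => (hw n).le) htlim
  have key : ∀ n, (s * c + (1 - s)) * S.nrm (w n - z) ^ 2
      ≤ s * (S.ω x - S.ω z - inner ℝ q (x - z)) + t n * (1 + ‖q‖) := by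
    intro n
    have h1 := h (w n) (hwY n)
    have h2 := S.sq_nrm_le_inner_sub (hwY n) (hp n) hz hq
    have h3 := hp n x hx
    have h4 : inner ℝ (p n - q) (w n - y) ≤ t n * (1 + ‖q‖) := by
      calc inner ℝ (p n - q) (w n - y) ≤ ‖p n - q‖ * ‖w n - y‖ := real_inner_le_norm _ _
        _ ≤ (‖p n‖ + ‖q‖) * ‖w n - y‖ := by gcongr; exact norm_sub_le _ _
        _ = ‖p n‖ * ‖w n - y‖ + ‖w n - y‖ * ‖q‖ := by ring
        _ ≤ t n + t n * ‖q‖ := by gcongr; exacts [(hpw n).le, (hw n).le]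
        _ = _ := by ring
    have h5 : s * inner ℝ (p n - q) (x - w n)
        = (1 - s) * inner ℝ (p n - q) (w n - z) - inner ℝ (p n - q) (w n - y) := by
      have : s • (x - w n) = (1 - s) • (w n - z) - (w n - y) := by rw [hy]; module
      rw [← inner_smul_right, this, inner_sub_right, inner_smul_right]
    have h6 : inner ℝ q (x - z) = inner ℝ q (x - w n) + inner ℝ q (w n - z) := by
      rw [← inner_add_right]; congr 1; abel
    rw [inner_sub_left (p n) q (x - w n)] at h5
    have h7 := mul_le_mul_of_nonneg_left h2 (sub_nonneg.2 hs1.le)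
    have h8 := mul_le_mul_of_nonneg_left h1 hs0.le
    have h9 := mul_le_mul_of_nonneg_left h3 hs0.le
    rw [h6]
    nlinarith
  have hl : Tendsto (fun n => (s * c + (1 - s)) * S.nrm (w n - z) ^ 2) atTop
      (𝓝 ((s * c + (1 - s)) * S.nrm (y - z) ^ 2)) :=
    (((hnrm.tendsto _).comp (hwlim.sub_const z)).pow 2).const_mul _
  have hr := (htlim.mul_const (1 + ‖q‖)).const_add (s * (S.ω x - S.ω z - inner ℝ q (x - z)))
  have hfin := le_of_tendsto_of_tendsto' hl hr key
  have hyz : y - z = s • (x - z) := by rw [hy]; abel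
  rw [hyz, map_smul_eq_mul, Real.norm_of_nonneg hs0.le, zero_mul, add_zero] at hfin
  refine le_of_mul_le_mul_left (le_of_eq_of_le ?_ hfin) hs0
  ring

/-- The map `c ↦ s² c + s (1 - s)` has the fixed point `s / (1 + s)`, which tends to `1/2` as `s →
1`. Iterating it from `c = 0` avoids integrating `ω'` along a segment on which it need not be
defined. -/
theorem quadratic_growth [FiniteDimensional ℝ E] {z q x : E} (hz : z ∈ S.Y)
    (hq : q ∈ subdiff S.Y S.ω z) (hx : x ∈ S.Y) :
    S.ω z + inner ℝ q (x - z) + S.nrm (x - z) ^ 2 / 2 ≤ S.ω x := by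
  set D := S.ω x - S.ω z - inner ℝ q (x - z) with hD
  set a := S.nrm (x - z) ^ 2 with ha
  suffices h : a - 2 * D ≤ 0 by linarith
  refine nonpos_of_forall_le_mul (b := a - D) fun t ht0 ht1 => ?_
  obtain ⟨s, rfl⟩ : ∃ s, t = 1 - s := ⟨1 - t, by ring⟩
  have hs0 : 0 < s := by linarith
  have hs1 : s < 1 := by linarith
  have hiter : ∀ n : ℕ, ∀ x ∈ S.Y, (s / (1 + s) * (1 - (s ^ 2) ^ n)) * S.nrm (x - z) ^ 2
      ≤ S.ω x - S.ω z - inner ℝ q (x - z) := by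
    intro n
    induction n with
    | zero =>
      intro x hx
      have := hq x hx
      simp only [pow_zero, sub_self, mul_zero, zero_mul]
      linarith
    | succ n ih =>
      intro x hx
      refine le_of_eq_of_le ?_ (S.improve_quadratic_growth hz hq hs0 hs1 ih x hx)
      congr 1
      field_simp
      ring
  have hlim : Tendsto (fun n : ℕ => (s / (1 + s) * (1 - (s ^ 2) ^ n)) * a) atTop
      (𝓝 ((s / (1 + s) * (1 - 0)) * a)) :=
    (((tendsto_pow_atTop_nhds_zero_of_lt_one (by positivity) (by nlinarith)).const_sub
      1).const_mul _).mul_const _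
  have hfin := le_of_tendsto' hlim fun n => hiter n x hx
  rw [sub_zero, mul_one, div_mul_eq_mul_div, div_le_iff₀ (by linarith)] at hfin
  linarith

theorem zero_mem_subdiff_of_isArgmin {u : E} (hu : S.IsArgmin S.Y u) :
    (0 : E) ∈ subdiff S.Y S.ω u := fun z hz => by simpa using hu.2 z hz

/-- Karush–Kuhn–Tucker conditions under Slater's condition. -/
theorem exists_lagrange_multipliers {ι : Type*} [Fintype ι] {h : ι → E → ℝ}
    (hconc : ∀ j, ConcaveOn ℝ S.Y (h j)) {l : ℝ} {u : E}
    (hu : S.IsArgmin {y | y ∈ S.Y ∧ ∀ j, l ≤ h j y} u) (hslater : ∃ z ∈ S.Y, ∀ j, l < h j z) :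
    ∃ μ : ι → ℝ, (∀ j, 0 ≤ μ j) ∧ (∀ j, μ j * (h j u - l) = 0) ∧
      ∀ y ∈ S.Y, S.ω u + ∑ j, μ j * (h j y - l) ≤ S.ω y := by
  -- The index `none` stands for the objective. At every point of `Y` either the objective is no
  -- better than at `u` or some constraint is violated. Slater's condition then excludes a zero
  -- weight on the objective.
  set φ : Option ι → E → ℝ := fun o y => o.elim (S.ω y - S.ω u) fun j => l - h j y with hφ
  obtain ⟨lam, ⟨hlam0, hlam1⟩, hlam⟩ := exists_mem_stdSimplex_sum_nonneg S.nonempty_Y (φ := φ)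
    (fun o => by
      cases o with
      | none => exact S.convexOn_ω.sub (concaveOn_const _ S.convex_Y)
      | some j => exact (convexOn_const _ S.convex_Y).sub (hconc j))
    (fun y hy => by
      by_cases hf : ∀ j, l ≤ h j y
      · exact ⟨none, sub_nonneg.2 (hu.2 y ⟨hy, hf⟩)⟩
      · push Not at hf
        obtain ⟨j, hj⟩ := hf
        exact ⟨some j, sub_nonneg.2 hj.le⟩)
  simp only [Fintype.sum_option, hφ, Option.elim] at hlam hlam1
  have h0 : 0 < lam none := by
    refine (hlam0 none).lt_of_ne' fun h0 => ?_
    obtain ⟨z, hz, hzl⟩ := hslater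
    have h1 := hlam z hz
    rw [h0, zero_mul, zero_add] at h1
    rw [h0, zero_add] at hlam1
    have hle : ∀ j ∈ Finset.univ, lam (some j) * (l - h j z) ≤ 0 := fun j _ =>
      mul_nonpos_of_nonneg_of_nonpos (hlam0 _) (by linarith [hzl j])
    have h2 := (Finset.sum_eq_zero_iff_of_nonpos hle).1 (le_antisymm (Finset.sum_nonpos hle) h1)
    have h3 : ∑ j, lam (some j) = 0 := Finset.sum_eq_zero fun j hj =>
      (mul_eq_zero.1 (h2 j hj)).resolve_right (by linarith [hzl j])
    linarith
  refine ⟨fun j => lam (some j) / lam none, fun j => div_nonneg (hlam0 _) h0.le, fun j => ?_,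
    fun y hy => ?_⟩
  · have h1 := hlam u hu.1.1
    rw [sub_self, mul_zero, zero_add] at h1
    have hle : ∀ j ∈ Finset.univ, lam (some j) * (l - h j u) ≤ 0 := fun j _ =>
      mul_nonpos_of_nonneg_of_nonpos (hlam0 _) (by linarith [hu.1.2 j])
    have h2 := (Finset.sum_eq_zero_iff_of_nonpos hle).1 (le_antisymm (Finset.sum_nonpos hle) h1)
      j (Finset.mem_univ j)
    rw [div_mul_eq_mul_div, div_eq_zero_iff]
    left; linarith
  · have h1 := hlam y hy
    have h2 : ∑ j, lam (some j) / lam none * (h j y - l)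
        = -(∑ j, lam (some j) * (l - h j y)) / lam none := by
      rw [← Finset.sum_neg_distrib, Finset.sum_div]
      exact Finset.sum_congr rfl fun j _ => by ring
    rw [h2, ← le_sub_iff_add_le', div_le_iff₀ h0]
    linarith

end ProximalSetup

/-! ### The affine functions of the bundle and their minimax value -/

theorem affVal_eq_add_inner {t : ℕ} (P : Protocol E t) (w : Fin t → ℝ) (u y : E) :
    affVal P w y = affVal P w u + inner ℝ (affGrad P w) (y - u) := by
  simp only [affVal, affGrad, inner_neg_left, sum_inner, inner_smul_left, conj_trivial,
    ← sub_eq_add_neg, ← Finset.sum_sub_distrib]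
  refine Finset.sum_congr rfl fun i _ => ?_
  rw [← mul_sub, ← inner_sub_right]
  congr 2
  abel

theorem continuous_affVal {t : ℕ} (P : Protocol E t) (w : Fin t → ℝ) :
    Continuous (affVal P w) := by
  unfold affVal
  fun_prop

theorem affVal_combo {t : ℕ} (P : Protocol E t) (w : Fin t → ℝ) (x y : E) {a b : ℝ}
    (hab : a + b = 1) : affVal P w (a • x + b • y) = a * affVal P w x + b * affVal P w y := by
  rw [affVal_eq_add_inner P w 0 (a • x + b • y), affVal_eq_add_inner P w 0 x,
    affVal_eq_add_inner P w 0 y]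
  simp only [sub_zero, inner_add_right, inner_smul_right]
  linear_combination -affVal P w 0 * hab

theorem continuous_iInf_affVal {t k : ℕ} (P : Protocol E t) (H : Fin (k + 1) → Fin t → ℝ) :
    Continuous fun z => ⨅ j, affVal P (H j) z := by
  simp only [← Finset.inf'_univ_eq_ciInf]
  exact Continuous.finset_inf'_apply _ fun j _ => continuous_affVal P (H j)

theorem concaveOn_affVal {t : ℕ} (P : Protocol E t) (w : Fin t → ℝ) {Y : Set E}
    (hY : Convex ℝ Y) : ConcaveOn ℝ Y (affVal P w) :=
  ⟨hY, fun _ _ _ _ _ _ _ _ hab => (affVal_combo P w _ _ hab).ge⟩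

theorem affVal_comb {t k : ℕ} (P : Protocol E t) (c : Fin k → ℝ) (H : Fin k → Fin t → ℝ) (z : E) :
    affVal P (comb c H) z = ∑ j, c j * affVal P (H j) z := by
  simp only [affVal, comb, Finset.sum_mul, Finset.mul_sum]
  rw [Finset.sum_comm]
  exact Finset.sum_congr rfl fun j _ => Finset.sum_congr rfl fun i _ => by ring

theorem comb_mem_stdSimplex {t k : ℕ} {c : Fin k → ℝ} (hc : c ∈ stdSimplex ℝ (Fin k))
    {H : Fin k → Fin t → ℝ} (hH : ∀ j, H j ∈ stdSimplex ℝ (Fin t)) :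
    comb c H ∈ stdSimplex ℝ (Fin t) := by
  refine ⟨fun i => Finset.sum_nonneg fun j _ => mul_nonneg (hc.1 j) ((hH j).1 i), ?_⟩
  simp only [comb]
  rw [Finset.sum_comm]
  simp only [← Finset.mul_sum, (hH _).2, mul_one, hc.2]

section
variable {Y : Set E} (hY : IsCompact Y) (hne : Y.Nonempty) {t k : ℕ} (P : Protocol E t)
include hY

theorem affVal_le_resolution (w : Fin t → ℝ) {z : E} (hz : z ∈ Y) :
    affVal P w z ≤ resolution Y P w :=
  le_csSup (hY.image (continuous_affVal P w)).bddAbove ⟨z, hz, rfl⟩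

include hne in
theorem exists_affVal_eq_resolution (w : Fin t → ℝ) :
    ∃ z ∈ Y, affVal P w z = resolution Y P w :=
  (hY.image (continuous_affVal P w)).sSup_mem (hne.image _)

theorem exists_affVal_le_optVal (H : Fin (k + 1) → Fin t → ℝ) {z : E} (hz : z ∈ Y) :
    ∃ j, affVal P (H j) z ≤ optVal Y P H := by
  obtain ⟨j, hj⟩ := exists_eq_ciInf_of_finite (f := fun j => affVal P (H j) z)
  refine ⟨j, hj.trans_le ?_⟩
  exact le_csSup (hY.image (continuous_iInf_affVal P H)).bddAbove ⟨z, hz, rfl⟩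

include hne in
theorem exists_forall_optVal_le (H : Fin (k + 1) → Fin t → ℝ) :
    ∃ z ∈ Y, ∀ j, optVal Y P H ≤ affVal P (H j) z := by
  obtain ⟨z, hz, h⟩ := (hY.image (continuous_iInf_affVal P H)).sSup_mem (hne.image _)
  refine ⟨z, hz, fun j => ?_⟩
  rw [optVal, ← h]
  exact ciInf_le (Finite.bddBelow_range _) j

include hne in
/-- von Neumann's minimax theorem for finitely many affine functions. -/
theorem exists_resolution_comb_eq_optVal (hc : Convex ℝ Y) (H : Fin (k + 1) → Fin t → ℝ) :
    ∃ lam ∈ stdSimplex ℝ (Fin (k + 1)), resolution Y P (comb lam H) = optVal Y P H := by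
  obtain ⟨lam, hlam, h⟩ := exists_mem_stdSimplex_sum_nonneg hne
    (φ := fun j z => optVal Y P H - affVal P (H j) z)
    (fun j => (convexOn_const _ hc).sub (concaveOn_affVal P (H j) hc))
    (fun y hy => by
      obtain ⟨j, hj⟩ := exists_affVal_le_optVal hY P H hy
      exact ⟨j, sub_nonneg.2 hj⟩)
  refine ⟨lam, hlam, le_antisymm ?_ ?_⟩
  · obtain ⟨z, hz, hzr⟩ := exists_affVal_eq_resolution hY hne P (comb lam H)
    have h1 := h z hz
    simp only [mul_sub, Finset.sum_sub_distrib, ← Finset.sum_mul, hlam.2, one_mul,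
      ← affVal_comb] at h1
    linarith
  · obtain ⟨z, hz, hzo⟩ := exists_forall_optVal_le hY hne P H
    refine le_trans ?_ (affVal_le_resolution hY P (comb lam H) hz)
    rw [affVal_comb]
    calc optVal Y P H = ∑ j, lam j * optVal Y P H := by rw [← Finset.sum_mul, hlam.2, one_mul]
      _ ≤ _ := Finset.sum_le_sum fun j _ => mul_le_mul_of_nonneg_left (hzo j) (hlam.1 j)

end

namespace State
variable {m t : ℕ} (σ : State E m t) (g : E → E)

theorem affVal_bundle_castSucc (j : Fin m) (z : E) :
    affVal (σ.newP g) (σ.bundle j.castSucc) z = affVal σ.P (σ.mem j) z := by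
  simp [affVal, newP, bundle, Fin.sum_univ_castSucc]

theorem affVal_bundle_last (z : E) :
    affVal (σ.newP g) (σ.bundle (Fin.last m)) z = inner ℝ (g σ.u) (σ.u - z) := by
  simp [affVal, newP, bundle, Fin.sum_univ_castSucc]

end State
end

namespace State
variable {E : Type*} {m t : ℕ} (σ : State E m t) (g : E → E)

theorem bundle_mem_stdSimplex (h : ∀ j, σ.mem j ∈ stdSimplex ℝ (Fin t)) (j : Fin (m + 1)) :
    σ.bundle j ∈ stdSimplex ℝ (Fin (t + 1)) := by
  refine Fin.lastCases ?_ (fun j => ?_) j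
  · simpa [bundle] using single_mem_stdSimplex ℝ (Fin.last t)
  · simp only [bundle, Fin.snoc_castSucc]
    refine ⟨fun i => ?_, ?_⟩
    · refine Fin.lastCases ?_ (fun i => ?_) i
      · simp
      · simpa using (h j).1 i
    · simpa [Fin.sum_univ_castSucc] using (h j).2

theorem newP_spec {Y : Set E} (h : ∀ i, (σ.P i).1 ∈ Y ∧ (σ.P i).2 = g (σ.P i).1)
    (hu : σ.u ∈ Y) (i : Fin (t + 1)) :
    (σ.newP g i).1 ∈ Y ∧ (σ.newP g i).2 = g (σ.newP g i).1 := by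
  refine Fin.lastCases ?_ (fun i => ?_) i
  · simpa [newP] using hu
  · simpa [newP] using h i

end State

section
variable {E : Type*} [NormedAddCommGroup E] [InnerProductSpace ℝ E]

namespace ProximalSetup
variable (S : ProximalSetup E)

theorem sub_le_sq_diam {y z : E} (hy : y ∈ S.Y) (hz : z ∈ S.Y) :
    2 * (S.ω y - S.ω z) ≤ S.diam ^ 2 := by
  have hc := S.isCompact_Y.image_of_continuousOn S.continuousOn_ω
  have h1 := le_csSup hc.bddAbove ⟨y, hy, rfl⟩
  have h2 := csInf_le hc.bddBelow ⟨z, hz, rfl⟩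
  have h3 := csInf_le hc.bddBelow ⟨y, hy, rfl⟩
  rw [diam, Real.sq_sqrt (by linarith)]
  linarith

theorem diam_nonneg : 0 ≤ S.diam := Real.sqrt_nonneg _

theorem nrm_sub_le_diam [FiniteDimensional ℝ E] {u y : E} (hu : S.IsArgmin S.Y u)
    (hy : y ∈ S.Y) : S.nrm (y - u) ≤ S.diam := by
  have h1 := S.quadratic_growth hu.1 (S.zero_mem_subdiff_of_isArgmin hu) hy
  have h2 := S.sub_le_sq_diam hy hu.1
  rw [inner_zero_left] at h1
  exact le_of_sq_le_sq (by linarith) S.diam_nonneg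

theorem inner_omega'_nonneg_of_isArgmin {u y : E} (hu : S.IsArgmin S.Y u) (hy : y ∈ S.Y) :
    0 ≤ inner ℝ (S.ω' u) (y - u) := by
  simpa using S.inner_omega'_sub_nonneg hu.1 (S.zero_mem_subdiff_of_isArgmin hu) hy

end ProximalSetup

/-! ### Existence of the choices that a step calls for -/

/-- A memory of `m` copies of one function will do, since its maximizer lies strictly above the
level. -/
theorem exists_beginsPhase (S : ProximalSetup E) {m t : ℕ} {γ : ℝ} (hγ : γ < 1) (P : Protocol E t)
    {w : Fin t → ℝ} (hw : w ∈ stdSimplex ℝ (Fin t)) (hf : 0 < resolution S.Y P w) :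
    ∃ σ : State E m t, BeginsPhase S γ P (resolution S.Y P w) σ := by
  obtain ⟨u, hu⟩ := S.exists_isArgmin S.isCompact_Y S.nonempty_Y subset_rfl
  obtain ⟨z, hz, hzr⟩ := exists_affVal_eq_resolution S.isCompact_Y S.nonempty_Y P w
  refine ⟨⟨P, resolution S.Y P w, fun _ => w, u⟩, rfl, rfl, fun _ => hw, ?_, hu⟩
  refine Set.Nonempty.closure ⟨z, hz, fun _ => ?_⟩
  rw [hzr]
  nlinarith

/-- The multipliers of the auxiliary minimization problem of a step, as subgradients. -/
theorem exists_step_multipliers (S : ProximalSetup E) {t k : ℕ} (P : Protocol E t)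
    (H : Fin (k + 1) → Fin t → ℝ) {l : ℝ} (hl : l < optVal S.Y P H) {u : E}
    (hu : S.IsArgmin {y | y ∈ S.Y ∧ ∀ j, l ≤ affVal P (H j) y} u) :
    ∃ μ : Fin (k + 1) → ℝ, (∀ j, 0 ≤ μ j) ∧ (∀ j, μ j * (affVal P (H j) u - l) = 0) ∧
      ∑ j, μ j • affGrad P (H j) ∈ subdiff S.Y S.ω u := by
  obtain ⟨z, hz, hzo⟩ := exists_forall_optVal_le S.isCompact_Y S.nonempty_Y P H
  obtain ⟨μ, hμ0, hμc, hμ⟩ := S.exists_lagrange_multipliers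
    (fun j => concaveOn_affVal P (H j) S.convex_Y) hu ⟨z, hz, fun j => hl.trans_le (hzo j)⟩
  refine ⟨μ, hμ0, hμc, fun y hy => ?_⟩
  refine le_of_eq_of_le ?_ (hμ y hy)
  congr 1
  rw [sum_inner]
  refine Finset.sum_congr rfl fun j _ => ?_
  rw [inner_smul_left, affVal_eq_add_inner P (H j) u y, conj_trivial]
  linear_combination -hμc j

theorem exists_continuesPhase (S : ProximalSetup E) (g : E → E) {γ : ℝ} {m t : ℕ}
    (σ : State E m t) (h : γ * σ.f < σ.opt S g) :
    ∃ σ' : State E m (t + 1), ContinuesPhase S g γ σ σ' := by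
  classical
  obtain ⟨z, hz, hzo⟩ := exists_forall_optVal_le S.isCompact_Y S.nonempty_Y (σ.newP g) σ.bundle
  have hcl : IsClosed {y | ∀ j, γ * σ.f ≤ affVal (σ.newP g) (σ.bundle j) y} := by
    simp only [Set.ofPred_forall]
    exact isClosed_iInter fun j => isClosed_le continuous_const (continuous_affVal _ _)
  obtain ⟨u, hu⟩ := S.exists_isArgmin (S.isCompact_Y.inter_right hcl)
    ⟨z, hz, fun j => h.le.trans (hzo j)⟩ Set.inter_subset_left
  obtain ⟨μ, hμ0, hμc, hμ⟩ := exists_step_multipliers S (σ.newP g) σ.bundle h hu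
  refine ⟨⟨σ.newP g, σ.f, fun j => if 0 < ∑ j, μ j then
      (if j.val = 0 then comb (fun i => (∑ k, μ k)⁻¹ * μ i) σ.bundle
        else σ.bundle (Fin.castSuccEmb j)) else σ.bundle (Fin.castSuccEmb j), u⟩,
    rfl, rfl, hu, μ, Fin.castSuccEmb, hμ0, hμc,
    fun y hy => S.inner_omega'_sub_nonneg hu.1.1 hμ hy, fun hpos j => ?_, fun hz j => ?_⟩
  · simp only [if_pos hpos]
  · simp only [if_neg hz.not_gt]

/-! ### Counting the steps -/

theorem resolution_le_diam_mul [FiniteDimensional ℝ E] (S : ProximalSetup E) {g : E → E} {L : ℝ}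
    (hg : ∀ y ∈ S.Y, dualNorm S.nrm (g y) ≤ L) {y : E} (hy : S.IsArgmin S.Y y) :
    resolution S.Y (fun _ : Fin 1 => (y, g y)) (fun _ => 1) ≤ S.diam * L := by
  obtain ⟨z, hz, h⟩ := exists_affVal_eq_resolution S.isCompact_Y S.nonempty_Y
    (fun _ : Fin 1 => (y, g y)) (fun _ => 1)
  rw [← h]
  simp only [affVal, Fin.sum_univ_one, one_mul]
  refine (inner_le_dualNorm_mul S.nrm_definite _ _).trans ?_
  rw [map_sub_rev, mul_comm]
  exact mul_le_mul (S.nrm_sub_le_diam hy hz) (hg y hy.1) (dualNorm_nonneg S.nrm_definite _)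
    S.diam_nonneg

/-- After one oracle call the simplex of weights is a single point, so every memory function is
`h_{y_1}`. -/
theorem opt_le_of_one_step (S : ProximalSetup E) (g : E → E) {m : ℕ} (hm : 1 ≤ m)
    {σ : State E m 1} (hσ : ∀ j, σ.mem j ∈ stdSimplex ℝ (Fin 1)) :
    σ.opt S g ≤ resolution S.Y σ.P (fun _ => 1) := by
  obtain ⟨z, hz, hzo⟩ := exists_forall_optVal_le S.isCompact_Y S.nonempty_Y (σ.newP g) σ.bundle
  have h1 := hzo (Fin.castSucc ⟨0, hm⟩)
  rw [σ.affVal_bundle_castSucc] at h1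
  have h2 : σ.mem ⟨0, hm⟩ = fun _ => 1 := by
    funext i
    have := (hσ ⟨0, hm⟩).2
    rw [Fin.sum_univ_one] at this
    rw [Subsingleton.elim i 0, this]
  rw [h2] at h1
  exact h1.trans (affVal_le_resolution S.isCompact_Y _ _ hz)

/-- What holds whenever the method has made `T` steps and is about to make the next step from the
state `σ`. The number `q` bounds the ratio of the numbers `f_s` of consecutive phases, and `y₀` is
the `ω`-center. -/
structure RunInvariant (S : ProximalSetup E) (g : E → E) (L γ q ε : ℝ) (y₀ : E) {m : ℕ} (T t : ℕ)
    (σ : State E m t) : Prop where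
  length : t = T
  protocol : ∀ i, (σ.P i).1 ∈ S.Y ∧ (σ.P i).2 = g (σ.P i).1
  mem_simplex : ∀ j, σ.mem j ∈ stdSimplex ℝ (Fin t)
  f_pos : 0 < σ.f
  f_le : σ.f ≤ S.diam * L
  u_mem : σ.u ∈ subdiffDomain S.Y S.ω
  halfspace : ∀ y ∈ S.Y, (∀ j, γ * σ.f ≤ affVal σ.P (σ.mem j) y) →
    0 ≤ inner ℝ (S.ω' σ.u) (y - σ.u)
  -- Initialization tests `f_1 = 0` and not `f_1 ≤ ε`, so `f_1` may be small already; the next step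
  -- then terminates, which is the source of the bound by two steps.
  large : ε < σ.f ∨ T = 1 ∧ σ.opt S g ≤ σ.f
  -- The first term on the right pays for the earlier phases, the second for the progress of `ω` in
  -- the current one.
  count : T * (γ ^ 2 * σ.f ^ 2 * (1 - q ^ 2)) ≤ (1 + γ ^ 2) * (S.diam * L) ^ 2 * q ^ 2
    + 2 * L ^ 2 * (1 - q ^ 2) * (S.ω σ.u - S.ω y₀)

theorem RunInvariant.of_beginsPhase {S : ProximalSetup E} {g : E → E} {L γ q ε : ℝ} {y₀ : E}
    (hy₀ : S.IsArgmin S.Y y₀) {m T t : ℕ} {P : Protocol E t} {f : ℝ} {σ : State E m t}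
    (hσ : BeginsPhase S γ P f σ) (hq : q ^ 2 ≤ 1) (ht : t = T)
    (hP : ∀ i, (P i).1 ∈ S.Y ∧ (P i).2 = g (P i).1) (hf0 : 0 < f) (hf : f ≤ S.diam * L)
    (hlarge : ε < f ∨ T = 1 ∧ σ.opt S g ≤ f)
    (hcount : T * (γ ^ 2 * f ^ 2 * (1 - q ^ 2)) ≤ (1 + γ ^ 2) * (S.diam * L) ^ 2 * q ^ 2) :
    RunInvariant S g L γ q ε y₀ T t σ := by
  obtain ⟨rfl, rfl, hmem, -, hu⟩ := hσ
  refine ⟨ht, hP, hmem, hf0, hf, ⟨hu.1, 0, S.zero_mem_subdiff_of_isArgmin hu⟩,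
    fun y hy _ => S.inner_omega'_nonneg_of_isArgmin hu hy, hlarge, hcount.trans ?_⟩
  have := hy₀.2 _ hu.1
  have : 0 ≤ 2 * L ^ 2 * (1 - q ^ 2) * (S.ω σ.u - S.ω y₀) :=
    mul_nonneg (mul_nonneg (by positivity) (by linarith)) (by linarith)
  linarith

namespace RunInvariant
variable {S : ProximalSetup E} {g : E → E} {L γ q ε : ℝ} {y₀ : E} {m T t : ℕ} {σ : State E m t}

/-- The step that ends a phase brings no progress in `ω`; it is paid for by `f ≤ Ω L`, whence the
summand `γ²` in `1 + γ²`. -/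
theorem succ_mul_le (h : RunInvariant S g L γ q ε y₀ T t σ) (hy₀ : y₀ ∈ S.Y) (hq : q ^ 2 ≤ 1) :
    (T + 1) * (γ ^ 2 * σ.f ^ 2 * (1 - q ^ 2)) ≤ (1 + γ ^ 2) * (S.diam * L) ^ 2 := by
  have h1 := h.count
  have h2 := S.sub_le_sq_diam h.u_mem.1 hy₀
  have h3 : L ^ 2 * (1 - q ^ 2) * (2 * (S.ω σ.u - S.ω y₀)) ≤ L ^ 2 * (1 - q ^ 2) * S.diam ^ 2 :=
    mul_le_mul_of_nonneg_left h2 (mul_nonneg (sq_nonneg _) (by linarith))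
  have h4 : σ.f ^ 2 ≤ (S.diam * L) ^ 2 := pow_le_pow_left₀ h.f_pos.le h.f_le 2
  have h5 : γ ^ 2 * (1 - q ^ 2) * σ.f ^ 2 ≤ γ ^ 2 * (1 - q ^ 2) * (S.diam * L) ^ 2 :=
    mul_le_mul_of_nonneg_left h4 (mul_nonneg (sq_nonneg _) (by linarith))
  have h6 : 0 ≤ q ^ 2 * γ ^ 2 * (S.diam * L) ^ 2 := by positivity
  nlinarith

theorem sq_mul_le [FiniteDimensional ℝ E] (h : RunInvariant S g L γ q ε y₀ T t σ)
    (hg : ∀ y ∈ S.Y, dualNorm S.nrm (g y) ≤ L) (hγ : 0 ≤ γ) {u : E} (hu : u ∈ S.Y)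
    (hfeas : ∀ j, γ * σ.f ≤ affVal (σ.newP g) (σ.bundle j) u) :
    γ ^ 2 * σ.f ^ 2 ≤ 2 * L ^ 2 * (S.ω u - S.ω σ.u) := by
  have h1 := h.halfspace u hu fun j => by
    rw [← σ.affVal_bundle_castSucc g]; exact hfeas _
  have h2 := S.quadratic_growth h.u_mem.1 (S.ω'_mem _ h.u_mem) hu
  have h3 := hfeas (Fin.last m)
  rw [σ.affVal_bundle_last] at h3
  have h4 : γ * σ.f ≤ L * S.nrm (u - σ.u) := by
    refine h3.trans ((inner_le_dualNorm_mul S.nrm_definite _ _).trans ?_)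
    rw [map_sub_rev]
    exact mul_le_mul_of_nonneg_right (hg _ h.u_mem.1) (apply_nonneg _ _)
  have h5 := pow_le_pow_left₀ (mul_nonneg hγ h.f_pos.le) h4 2
  have h6 : L ^ 2 * S.nrm (u - σ.u) ^ 2 ≤ L ^ 2 * (2 * (S.ω u - S.ω σ.u)) :=
    mul_le_mul_of_nonneg_left (by linarith) (sq_nonneg _)
  nlinarith

theorem continuesPhase [FiniteDimensional ℝ E] (h : RunInvariant S g L γ q ε y₀ T t σ)
    (hg : ∀ y ∈ S.Y, dualNorm S.nrm (g y) ≤ L) (hm : 1 ≤ m) (hγ : 0 ≤ γ) (hq : q ^ 2 ≤ 1)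
    (hopt : γ * σ.f < σ.opt S g) (hε : ε < σ.opt S g) {σ' : State E m (t + 1)}
    (hσ' : ContinuesPhase S g γ σ σ') : RunInvariant S g L γ q ε y₀ (T + 1) (t + 1) σ' := by
  obtain ⟨hP, hf, hu, μ, e, hμ0, hμc, hμv, hmem, hmem'⟩ := hσ'
  have hbun := σ.bundle_mem_stdSimplex h.mem_simplex
  have hsum : 0 ≤ ∑ j, μ j := Finset.sum_nonneg fun j _ => hμ0 j
  -- The multipliers `μ` of the method speak only of `ω'`, which means nothing outside `Y^o`. The
  -- separate `ν` show that the new point lies in `Y^o`.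
  obtain ⟨ν, -, -, hν⟩ := exists_step_multipliers S (σ.newP g) σ.bundle hopt hu
  refine ⟨by rw [h.length], ?_, ?_, hf ▸ h.f_pos, hf ▸ h.f_le, ⟨hu.1.1, _, hν⟩, ?_, ?_, ?_⟩
  · rw [hP]
    exact σ.newP_spec g h.protocol h.u_mem.1
  · intro j
    rcases hsum.eq_or_lt with h0 | hpos
    · rw [hmem' h0.symm]
      exact hbun _
    · rw [hmem hpos]
      split_ifs
      · refine comb_mem_stdSimplex ⟨fun j => mul_nonneg (inv_nonneg.2 hsum) (hμ0 j), ?_⟩ hbun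
        rw [← Finset.mul_sum, inv_mul_cancel₀ hpos.ne']
      · exact hbun _
  · intro y hy hyf
    have hvar := hμv y hy
    rw [inner_sub_left] at hvar
    refine le_trans ?_ (sub_nonneg.1 hvar)
    have hgrad : inner ℝ (∑ j, μ j • affGrad (σ.newP g) (σ.bundle j)) (y - σ'.u)
        = ∑ j, μ j * affVal (σ.newP g) (σ.bundle j) y - (∑ j, μ j) * (γ * σ.f) := by
      rw [sum_inner, Finset.sum_mul, ← Finset.sum_sub_distrib]
      refine Finset.sum_congr rfl fun j _ => ?_
      rw [inner_smul_left, affVal_eq_add_inner _ _ σ'.u y, conj_trivial]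
      linear_combination -hμc j
    rw [hgrad]
    rcases hsum.eq_or_lt with h0 | hpos
    · have hz := (Finset.sum_eq_zero_iff_of_nonneg fun j _ => hμ0 j).1 h0.symm
      rw [← h0, zero_mul, sub_zero]
      exact (Finset.sum_eq_zero fun j hj => by rw [hz j hj, zero_mul]).ge
    -- Memory slot `0` holds the aggregate, and this single constraint implies the half-space
    -- inequality.
    · have h1 := hyf ⟨0, hm⟩
      rw [hmem hpos, if_pos rfl, hP, hf, affVal_comb] at h1
      simp only [mul_assoc] at h1
      rw [← Finset.mul_sum, le_inv_mul_iff₀ hpos] at h1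
      linarith
  · left
    rcases h.large with h1 | ⟨-, h1⟩
    · rwa [hf]
    · rw [hf]; exact hε.trans_le h1
  · have h1 := h.count
    have h2 := mul_le_mul_of_nonneg_right (h.sq_mul_le hg hγ hu.1.1 hu.1.2) (sub_nonneg.2 hq)
    rw [hf]
    push_cast
    nlinarith

end RunInvariant


theorem le_complexityConst_mul {γ θ ε D f n : ℝ} (hγ : 0 < γ)
    (hq : (γ + (1 - γ) * θ) ^ 2 < 1) (hε : 0 < ε) (hf : ε ≤ f) (hn : 0 ≤ n)
    (h : n * (γ ^ 2 * f ^ 2 * (1 - (γ + (1 - γ) * θ) ^ 2)) ≤ (1 + γ ^ 2) * D ^ 2) :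
    n ≤ complexityConst γ θ * (D ^ 2 / ε ^ 2) := by
  have hW := sub_pos.2 hq
  rw [complexityConst, div_mul_div_comm, le_div_iff₀ (by positivity)]
  refine le_trans ?_ h
  have : ε ^ 2 ≤ f ^ 2 := pow_le_pow_left₀ hε.le hf 2
  calc n * (γ ^ 2 * (1 - (γ + (1 - γ) * θ) ^ 2) * ε ^ 2)
      ≤ n * (γ ^ 2 * (1 - (γ + (1 - γ) * θ) ^ 2) * f ^ 2) := by gcongr
    _ = _ := by ring

theorem two_le_complexityConst_mul {γ θ ε D : ℝ} (hγ : 0 < γ) (hγ1 : γ < 1)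
    (hq : (γ + (1 - γ) * θ) ^ 2 < 1) (hε : 0 < ε) (hD : ε ≤ D) :
    2 ≤ complexityConst γ θ * (D ^ 2 / ε ^ 2) := by
  refine le_complexityConst_mul hγ hq hε hD zero_le_two ?_
  have h1 : γ ^ 2 ≤ 1 := pow_le_one₀ hγ.le hγ1.le
  have h2 : γ ^ 2 * (1 - (γ + (1 - γ) * θ) ^ 2) ≤ γ ^ 2 * 1 :=
    mul_le_mul_of_nonneg_left (by linarith [sq_nonneg (γ + (1 - γ) * θ)]) (sq_nonneg _)
  nlinarith [mul_le_mul_of_nonneg_right h2 (sq_nonneg D), sq_nonneg D]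

/-- The invariant of the method: what holds of the configurations reached in `T` steps. -/
def ConfigInvariant (S : ProximalSetup E) (g : E → E) (L γ θ ε : ℝ) (y₀ : E) {m : ℕ} (T : ℕ) :
    Config E m → Prop
  | .start => T = 0
  | .running t σ => RunInvariant S g L γ (γ + (1 - γ) * θ) ε y₀ T t σ
  | .done t P lam => t = T ∧ (∀ i, (P i).1 ∈ S.Y ∧ (P i).2 = g (P i).1) ∧
      lam ∈ stdSimplex ℝ (Fin t) ∧ resolution S.Y P lam ≤ ε ∧
      (ε ≤ S.diam * L → (T : ℝ) ≤ complexityConst γ θ * ((S.diam * L) ^ 2 / ε ^ 2)) ∧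
      (S.diam * L < ε → T ≤ 2)

theorem RunInvariant.step_bound {S : ProximalSetup E} {g : E → E} {L γ θ ε : ℝ} {y₀ : E}
    {m T t : ℕ} {σ : State E m t} (h : RunInvariant S g L γ (γ + (1 - γ) * θ) ε y₀ T t σ)
    (hy₀ : y₀ ∈ S.Y) (hγ : 0 < γ) (hγ1 : γ < 1) (hq : (γ + (1 - γ) * θ) ^ 2 < 1) (hε : 0 < ε) :
    (ε ≤ S.diam * L → (T : ℝ) + 1 ≤ complexityConst γ θ * ((S.diam * L) ^ 2 / ε ^ 2)) ∧
      (S.diam * L < ε → T + 1 ≤ 2) := by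
  rcases h.large with hl | ⟨rfl, -⟩
  · exact ⟨fun _ => le_complexityConst_mul hγ hq hε hl.le (by positivity)
      (h.succ_mul_le hy₀ hq.le), fun hD => absurd h.f_le (by linarith)⟩
  · refine ⟨fun hD => ?_, fun _ => le_rfl⟩
    have := two_le_complexityConst_mul hγ hγ1 hq hε hD
    norm_num
    linarith

theorem ConfigInvariant.step [FiniteDimensional ℝ E] {S : ProximalSetup E} {g : E → E} {L : ℝ}
    (hg : ∀ y ∈ S.Y, dualNorm S.nrm (g y) ≤ L) {m : ℕ} (hm : 1 ≤ m) {γ θ ε : ℝ}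
    (hγ : γ ∈ Set.Ioo (0 : ℝ) 1) (hθ : θ ∈ Set.Ioo (0 : ℝ) 1) (hε : 0 < ε) {y₀ : E}
    (hy₀ : S.IsArgmin S.Y y₀) {T : ℕ} {c c' : Config E m}
    (hc : ConfigInvariant S g L γ θ ε y₀ T c) (hstep : Step S g γ θ ε c c') :
    ConfigInvariant S g L γ θ ε y₀ (T + 1) c' := by
  obtain ⟨hγ0, hγ1⟩ := hγ
  obtain ⟨hθ0, hθ1⟩ := hθ
  have hγq : γ ≤ γ + (1 - γ) * θ := by nlinarith
  have hq0 : 0 ≤ γ + (1 - γ) * θ := by linarith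
  have hq1 : γ + (1 - γ) * θ < 1 := by nlinarith
  have hq : (γ + (1 - γ) * θ) ^ 2 < 1 := pow_lt_one₀ hq0 hq1 two_ne_zero
  cases hstep with
  | initStop y hy hf =>
    obtain rfl : T = 0 := hc
    refine ⟨rfl, fun i => ⟨hy.1, rfl⟩, ⟨fun _ => zero_le_one, by simp⟩, hf ▸ hε.le, fun hD => ?_,
      fun _ => by norm_num⟩
    have := two_le_complexityConst_mul hγ0 hγ1 hq hε hD
    norm_num
    linarith
  | initPhase y hy hf σ hσ =>
    obtain rfl : T = 0 := hc
    have hfD := resolution_le_diam_mul S hg hy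
    refine RunInvariant.of_beginsPhase hy₀ hσ hq.le rfl (fun i => ⟨hy.1, rfl⟩) hf hfD
      (Or.inr ⟨rfl, ?_⟩) ?_
    · have := opt_le_of_one_step S g hm hσ.2.2.1
      rwa [hσ.1] at this
    · set q := γ + (1 - γ) * θ
      set f := resolution S.Y (fun _ : Fin 1 => (y, g y)) (fun _ => 1)
      have h1 : f ^ 2 ≤ (S.diam * L) ^ 2 := pow_le_pow_left₀ hf.le hfD 2
      -- The initialization counts as a step, but no earlier phase exists to pay for it; `γ ≤ q`
      -- lets the first term of the potential cover it.
      have h2 : γ ^ 2 ≤ q ^ 2 := pow_le_pow_left₀ hγ0.le hγq 2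
      calc ((0 + 1 : ℕ) : ℝ) * (γ ^ 2 * f ^ 2 * (1 - q ^ 2)) = γ ^ 2 * f ^ 2 * (1 - q ^ 2) := by
            norm_num
        _ ≤ γ ^ 2 * f ^ 2 * 1 := by
            gcongr
            linarith [sq_nonneg q]
        _ ≤ q ^ 2 * (S.diam * L) ^ 2 * (1 + γ ^ 2) := by
            gcongr
            linarith [sq_nonneg γ]
        _ = _ := by ring
  | terminate t σ hA lam hlam =>
    have hc : RunInvariant S g L γ (γ + (1 - γ) * θ) ε y₀ T t σ := hc
    refine ⟨by rw [hc.length], σ.newP_spec g hc.protocol hc.u_mem.1,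
      comb_mem_stdSimplex hlam.1 (σ.bundle_mem_stdSimplex hc.mem_simplex), hlam.2 ▸ hA, ?_⟩
    simpa using hc.step_bound hy₀.1 hγ0 hγ1 hq hε
  | newPhase t σ hA hB lam hlam σ' hσ' =>
    have hc : RunInvariant S g L γ (γ + (1 - γ) * θ) ε y₀ T t σ := hc
    rw [hlam.2] at hσ'
    have hBq : σ.opt S g ≤ (γ + (1 - γ) * θ) * σ.f := by linarith
    refine RunInvariant.of_beginsPhase hy₀ hσ' hq.le (by rw [hc.length])
      (σ.newP_spec g hc.protocol hc.u_mem.1) (hε.trans hA) ?_ (Or.inl hA) ?_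
    · have := mul_le_mul_of_nonneg_right hq1.le hc.f_pos.le
      linarith [hc.f_le]
    · have h1 := hc.succ_mul_le hy₀.1 hq.le
      -- The new value is at most `q f`, so the bound at the end of the old phase gains the factor
      -- `q²`: this is one term of the geometric series.
      set q := γ + (1 - γ) * θ
      have h2 : σ.opt S g ^ 2 ≤ (q * σ.f) ^ 2 := pow_le_pow_left₀ (hε.trans hA).le hBq 2
      have hW : 0 ≤ 1 - q ^ 2 := by linarith
      calc ((T + 1 : ℕ) : ℝ) * (γ ^ 2 * σ.opt S g ^ 2 * (1 - q ^ 2))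
          ≤ ((T + 1 : ℕ) : ℝ) * (γ ^ 2 * (q * σ.f) ^ 2 * (1 - q ^ 2)) := by gcongr
        _ = ((T + 1) * (γ ^ 2 * σ.f ^ 2 * (1 - q ^ 2))) * q ^ 2 := by push_cast; ring
        _ ≤ _ := mul_le_mul_of_nonneg_right h1 (sq_nonneg _)
  | samePhase t σ hA hC σ' hσ' =>
    have hc : RunInvariant S g L γ (γ + (1 - γ) * θ) ε y₀ T t σ := hc
    have : 0 < θ * (σ.f - γ * σ.f) := mul_pos hθ0 (by nlinarith [hc.f_pos])
    exact hc.continuesPhase hg hm hγ0.le hq.le (by linarith) hA hσ'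

/-! ### The method never gets stuck -/

theorem RunInvariant.exists_step {S : ProximalSetup E} {g : E → E} {L γ θ q ε : ℝ} {y₀ : E}
    {m T t : ℕ} {σ : State E m t} (h : RunInvariant S g L γ q ε y₀ T t σ) (hγ : γ < 1)
    (hθ : 0 < θ) (hε : 0 < ε) : ∃ c', Step S g γ θ ε (Config.running t σ) c' := by
  obtain ⟨lam, hlam, hopt⟩ := exists_resolution_comb_eq_optVal S.isCompact_Y S.nonempty_Y
    (σ.newP g) S.convex_Y σ.bundle
  rcases le_or_gt (σ.opt S g) ε with hA | hA
  · exact ⟨_, Step.terminate t σ hA lam ⟨hlam, hopt⟩⟩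
  rcases lt_or_ge (σ.opt S g) (γ * σ.f + θ * (σ.f - γ * σ.f)) with hB | hC
  · obtain ⟨σ', hσ'⟩ := exists_beginsPhase S (m := m) hγ (σ.newP g)
      (comb_mem_stdSimplex hlam (σ.bundle_mem_stdSimplex h.mem_simplex))
      (hopt ▸ hε.trans hA)
    exact ⟨_, Step.newPhase t σ hA hB lam ⟨hlam, hopt⟩ σ' hσ'⟩
  · have : 0 < θ * (σ.f - γ * σ.f) := mul_pos hθ (by nlinarith [h.f_pos])
    obtain ⟨σ', hσ'⟩ := exists_continuesPhase S g (γ := γ) σ (by linarith)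
    exact ⟨_, Step.samePhase t σ hA hC σ' hσ'⟩

theorem exists_step_start (S : ProximalSetup E) (g : E → E) {m : ℕ} {γ θ ε : ℝ} (hγ : γ < 1) :
    ∃ c' : Config E m, Step S g γ θ ε Config.start c' := by
  obtain ⟨y, hy⟩ := S.exists_isArgmin S.isCompact_Y S.nonempty_Y subset_rfl
  have h0 : 0 ≤ resolution S.Y (fun _ : Fin 1 => (y, g y)) (fun _ => 1) := by
    refine le_of_eq_of_le ?_ (affVal_le_resolution S.isCompact_Y _ _ hy.1)
    simp [affVal]
  rcases h0.eq_or_lt with hf | hf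
  · exact ⟨_, Step.initStop y hy hf.symm⟩
  · obtain ⟨σ, hσ⟩ := exists_beginsPhase S (m := m) hγ (fun _ : Fin 1 => (y, g y))
      (w := fun _ => 1) ⟨fun _ => zero_le_one, by simp⟩ hf
    exact ⟨_, Step.initPhase y hy hf σ hσ⟩

end
end NERML

theorem proposition6 {E : Type*} [NormedAddCommGroup E] [InnerProductSpace ℝ E]
    [FiniteDimensional ℝ E] (S : NERML.ProximalSetup E) (g : E → E) (L : ℝ)
    (hg : ∀ y ∈ S.Y, NERML.dualNorm S.nrm (g y) ≤ L)
    (m : ℕ) (hm : 1 ≤ m) (γ θ : ℝ) (hγ : γ ∈ Set.Ioo (0 : ℝ) 1) (hθ : θ ∈ Set.Ioo (0 : ℝ) 1)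
    (ε : ℝ) (hε : 0 < ε) :
    -- the method never gets stuck: as long as it has not terminated, its next step can be made
    (∀ (T : ℕ) (c : NERML.Config E m), NERML.ReachedIn S g γ θ ε T c →
      (∃ (t : ℕ) (P : NERML.Protocol E t) (lam : Fin t → ℝ), c = NERML.Config.done t P lam) ∨
      ∃ c' : NERML.Config E m, NERML.Step S g γ θ ε c c') ∧
    -- whatever choices are made, the number of steps is bounded
    (∀ (T : ℕ) (c : NERML.Config E m), NERML.ReachedIn S g γ θ ε T c →
      (ε ≤ S.diam * L →
        (T : ℝ) ≤ NERML.complexityConst γ θ * (S.diam ^ 2 * L ^ 2 / ε ^ 2)) ∧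
      (S.diam * L < ε → T ≤ 2)) ∧
    -- upon termination after `T` steps, the output is an execution protocol of length `T` with an
    -- accuracy certificate of resolution at most `ε`
    (∀ (T t : ℕ) (P : NERML.Protocol E t) (lam : Fin t → ℝ),
      NERML.ReachedIn S g γ θ ε T (NERML.Config.done t P lam : NERML.Config E m) →
      t = T ∧ (∀ i, (P i).1 ∈ S.Y ∧ (P i).2 = g (P i).1) ∧
      (∀ i, 0 ≤ lam i) ∧ ∑ i, lam i = 1 ∧ NERML.resolution S.Y P lam ≤ ε) := by
  obtain ⟨y₀, hy₀⟩ := S.exists_isArgmin S.isCompact_Y S.nonempty_Y subset_rfl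
  have hq : (γ + (1 - γ) * θ) ^ 2 < 1 :=
    pow_lt_one₀ (by nlinarith [hγ.1, hγ.2, hθ.1]) (by nlinarith [hγ.2, hθ.2]) two_ne_zero
  have hinv : ∀ (T : ℕ) (c : NERML.Config E m), NERML.ReachedIn S g γ θ ε T c →
      NERML.ConfigInvariant S g L γ θ ε y₀ T c := by
    intro T c hc
    induction hc with
    | zero => exact rfl
    | succ T c c' _ hstep ih => exact ih.step hg hm hγ hθ hε hy₀ hstep
  refine ⟨fun T c hc => ?_, fun T c hc => ?_, fun T t P lam hc => ?_⟩
  · cases c with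
    | start => exact Or.inr (NERML.exists_step_start S g hγ.2)
    | running t σ =>
      have h : NERML.RunInvariant S g L γ (γ + (1 - γ) * θ) ε y₀ T t σ := hinv T _ hc
      exact Or.inr (h.exists_step hγ.2 hθ.1 hε)
    | done t P lam => exact Or.inl ⟨t, P, lam, rfl⟩
  · rw [← mul_pow]
    cases c with
    | start =>
      obtain rfl : T = 0 := hinv T _ hc
      refine ⟨fun hD => ?_, fun _ => by norm_num⟩
      have := NERML.two_le_complexityConst_mul hγ.1 hγ.2 hq hε hD
      norm_num
      linarith
    | running t σ =>
      have h : NERML.RunInvariant S g L γ (γ + (1 - γ) * θ) ε y₀ T t σ := hinv T _ hc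
      have h1 := h.step_bound hy₀.1 hγ.1 hγ.2 hq hε
      exact ⟨fun hD => by linarith [h1.1 hD], fun hD => by linarith [h1.2 hD]⟩
    | done t P lam =>
      obtain ⟨-, -, -, -, h⟩ := hinv T _ hc
      exact h
  · obtain ⟨h1, h2, h3, h4, -⟩ := hinv T _ hc
    exact ⟨h1, h2, h3.1, h3.2, h4⟩
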